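/- A real number $\beta\in(1,2)$ is called a Garsia number if it is an algebraic integer of norm $\pm 2$ (the norm from $\mathbb{Q}(\beta)$ to $\mathbb{Q}$) all of whose Galois conjugates have modulus strictly greater than $1$. For $\lambda\in(1/2,1)$ let $S_\lambda=\{S_0(x)=\lambda x,\ S_1(x)=\lambda x+1\}$, an iterated function system on $\mathbb{R}$ whose invariant set (the unique non-empty compact set $X$ with $X=S_0(X)\cup S_1(X)$) is $[0,\frac{1}{1-\lambda}]$, and let $T_i=S_i^{-1}$ for $i\in\{0,1\}$. For $h:\mathbb{N}\to[0,\infty)$ let $$R(S_\lambda,h)=\left\{x\in X:\ (T_{i_N}\circ\cdots\circ T_{i_1})(x)\in B\!\left(x,\frac{h(N)}{(2\lambda)^N}\right)\text{ for infinitely many }(i_1,\ldots,i_N)\in\bigcup_{n=1}^{\infty}\{0,1\}^n\right\},$$ where $B(x,r)=\{y\in\mathbb{R}:|x-y|<r\}$. **Theorem.** Let $\lambda\in(1/2,1)$ be such that $\lambda^{-1}$ is a Garsia number. Then for any $h:\mathbb{N}\to[0,\infty)$ satisfying $\sum_{n=1}^{\infty}h(n)=\infty$, Lebesgue almost every $x\in[0,\frac{1}{1-\lambda}]$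 is contained in $R(S_\lambda,h)$. -/

import Mathlib

open MeasureTheory
open scoped NNReal

/-- An affine iterated function system: maps `S i x = A i x + t i`, indexed by a finite set, with
every linear part `A i` invertible and of operator norm strictly less than `1`. -/
structure AffineIFS (ι E : Type*) [Fintype ι] [NormedAddCommGroup E] [NormedSpace ℝ E] where
  lin : ι → E ≃L[ℝ] E
  norm_lin_lt_one : ∀ i, ‖(lin i : E →L[ℝ] E)‖ < 1
  trans : ι → E

namespace AffineIFS

section

variable {ι E : Type*} [Fintype ι] [NormedAddCommGroup E] [NormedSpace ℝ E]

/-- The contraction `S i x = A i x + t i`. -/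
def S (Φ : AffineIFS ι E) (i : ι) (x : E) : E := Φ.lin i x + Φ.trans i

/-- The inverse map `T i = (S i)⁻¹`. -/
def T (Φ : AffineIFS ι E) (i : ι) (x : E) : E := (Φ.lin i).symm (x - Φ.trans i)

theorem S_T (Φ : AffineIFS ι E) (i : ι) (x : E) : Φ.S i (Φ.T i x) = x := by simp [S, T]

theorem T_S (Φ : AffineIFS ι E) (i : ι) (x : E) : Φ.T i (Φ.S i x) = x := by simp [S, T]

/-- The invariant set `X`: the unique nonempty compact set with `X = ⋃ i, S i (X)`
(written as the union of all such sets, of which there is at most one). -/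
def attractor (Φ : AffineIFS ι E) : Set E :=
  ⋃₀ {K : Set E | K.Nonempty ∧ IsCompact K ∧ K = ⋃ i, Φ.S i '' K}

/-- `λ(𝒜) = ∑ i, |det (A i)|`. -/
noncomputable def detSum (Φ : AffineIFS ι E) : ℝ :=
  ∑ i, |LinearMap.det ((Φ.lin i : E →L[ℝ] E) : E →ₗ[ℝ] E)|

/-- `T_{i_N} ∘ ⋯ ∘ T_{i_1}` for the word `[i_1, …, i_N]`; the map `T_{i_1}` is applied first. -/
def orbit (Φ : AffineIFS ι E) (w : List ι) (x : E) : E := w.foldl (fun y i => Φ.T i y) x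

/-- The recurrence set `R(Φ, h)`: the points `x` of the invariant set such that
`(T_{i_N} ∘ ⋯ ∘ T_{i_1}) x` lies in the ball about `x` of radius `(h(N) / λ(𝒜)^N)^(1/d)`
for infinitely many finite words `i_1 ⋯ i_N` with `N ≥ 1`, where `d` is the dimension. -/
def recurrenceSet (Φ : AffineIFS ι E) (h : ℕ → ℝ≥0) : Set E :=
  {x | x ∈ Φ.attractor ∧
    {w : List ι | w ≠ [] ∧ Φ.orbit w x ∈ Metric.ball x
      (((h w.length : ℝ) / Φ.detSum ^ w.length) ^ (1 / (Module.finrank ℝ E : ℝ)))}.Infinite}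

end

end AffineIFS

/-- The iterated function system `{x ↦ l * x, x ↦ l * x + 1}` on the real line. -/
noncomputable def bernoulliIFS (l : ℝ) (hl : l ∈ Set.Ioo (1 / 2 : ℝ) 1) : AffineIFS (Fin 2) ℝ where
  lin _ := ContinuousLinearEquiv.smulLeft
    (Units.mk0 l (ne_of_gt (lt_trans (by norm_num) hl.1)))
  norm_lin_lt_one _ := by
    have h0 : 0 < l := lt_trans (by norm_num) hl.1
    refine lt_of_le_of_lt (ContinuousLinearMap.opNorm_le_bound _ h0.le fun x => ?_) hl.2
    simp [Units.smul_def, abs_of_pos h0]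
  trans := ![0, 1]

/-- A Garsia number: a real algebraic integer in `(1, 2)` of norm `±2` (from `ℚ(β)` to `ℚ`), all of
whose Galois conjugates have modulus strictly greater than `1`. -/
def IsGarsiaNumber (β : ℝ) : Prop :=
  β ∈ Set.Ioo (1 : ℝ) 2 ∧ IsIntegral ℤ β ∧
    (Algebra.norm ℚ (IntermediateField.AdjoinSimple.gen ℚ β) = 2 ∨
      Algebra.norm ℚ (IntermediateField.AdjoinSimple.gen ℚ β) = -2) ∧
    ∀ z : ℂ, IsConjRoot ℚ (β : ℂ) z → 1 < ‖z‖

/-!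
Put `b = l⁻¹` and `X = [0, b / (b - 1)]`. For a word `w` of length `N` the expanding map satisfies
`T_w x - x = (b ^ N - 1) * (x - x_w)`, where `x_w` is its fixed point, so within `X` the
recurrence set contains the limsup set of the balls of radius `h N / 2 ^ N` about the `2 ^ N`
points `x_w`, `|w| = N`.
Replacing `h` by `min h 1` keeps the series divergent.

The Garsia property enters through a norm computation (`IsGarsiaNumber.exists_separation`): for two
different words of length `N` the difference of the word sums is a nonzero algebraic integer whose
other conjugates are bounded by a constant times the `N`-th powers of the other conjugates of `b`,
whose moduli have product `2 / b`. So the word sums are `c * (b / 2) ^ N`-separated and the `x_w` are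
`c / 2 ^ N`-separated.

Let `f_k y` be the number of words `u` of length `k` with `y ∈ S_u (X)`, divided by `(2 / b) ^ k`.
Separation bounds `f_k` uniformly, and `∫ f_k = |X|`. The set where `f_k → 0` is mapped into itself
by the expanding maps, so blowing it up at a density point shows that it is null or co-null in `X`,
and dominated convergence excludes the latter. Hence for almost every `y` some `δ > 0` satisfies
`f_k y ≥ δ` for infinitely many `k` (`ae_exists_frequently_le_coverCount`).

For such `y` and `k`, at least `δ * b ^ (-k) * 2 ^ N` of the points `x_w` with `|w| = N ≥ k` lie
within `O(b ^ (-k))` of `y`. By separation the balls about them are quasi-independent, and a second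
moment estimate (`measureReal_iUnion_ball_ge`) shows that those with `N ≥ n₀` cover a fixed
proportion of a ball about `y` of radius comparable to `b ^ (-k)`. So the complement of the union
of all balls with `N ≥ n₀` has no such `y` as a density point, and is therefore null in `X`.
-/

open Filter Topology

/-! ### Separation of word sums -/

/-- The number `∑ k, i_k z ^ (N - k + 1)` attached to the word `[i_1, …, i_N]` of zeros and ones,
in Horner form. -/
def wordSum {R : Type*} [CommRing R] (z : R) (w : List (Fin 2)) : R :=
  w.foldl (fun y (i : Fin 2) => z * (y + ((i : ℕ) : R))) 0

theorem wordSum_concat {R : Type*} [CommRing R] (z : R) (w : List (Fin 2)) (i : Fin 2) :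
    wordSum z (w ++ [i]) = z * (wordSum z w + ((i : ℕ) : R)) := by
  simp [wordSum]

theorem wordSum_cons {R : Type*} [CommRing R] (z : R) (i : Fin 2) (w : List (Fin 2)) :
    wordSum z (i :: w) = z ^ (w.length + 1) * ((i : ℕ) : R) + wordSum z w := by
  induction w using List.reverseRecOn with
  | nil => simp [wordSum]
  | append_singleton w j ih =>
    rw [← List.cons_append, wordSum_concat, ih, wordSum_concat]
    simp only [List.length_append, List.length_singleton]
    ring

theorem map_wordSum {R R' : Type*} [CommRing R] [CommRing R'] (f : R →+* R') (z : R)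
    (w : List (Fin 2)) : f (wordSum z w) = wordSum (f z) w := by
  induction w using List.reverseRecOn with
  | nil => simp [wordSum]
  | append_singleton w i ih => simp [wordSum_concat, ih]

theorem dvd_wordSum {R : Type*} [CommRing R] (z : R) (w : List (Fin 2)) : z ∣ wordSum z w := by
  induction w using List.reverseRecOn with
  | nil => simp [wordSum]
  | append_singleton w i ih => simp [wordSum_concat]

/-- If `z` is not a unit, then words are determined by their sums: the last digit is determined
modulo `z`. -/
theorem eq_of_wordSum_eq {R : Type*} [CommRing R] [IsDomain R] {z : R} (hz0 : z ≠ 0)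
    (hz : ¬ IsUnit z) (w : List (Fin 2)) :
    ∀ w' : List (Fin 2), w.length = w'.length → wordSum z w = wordSum z w' → w = w' := by
  induction w using List.reverseRecOn with
  | nil => intro w' hl _; exact (List.eq_nil_of_length_eq_zero hl.symm).symm
  | append_singleton w i ih =>
    intro w'
    cases w' using List.reverseRecOn with
    | nil => intro hl; simp at hl
    | append_singleton w' j =>
      intro hl h
      rw [wordSum_concat, wordSum_concat] at h
      have h1 := mul_left_cancel₀ hz0 h
      have hd : z ∣ (((i : ℕ) : R) - ((j : ℕ) : R)) := by
        have : (((i : ℕ) : R) - ((j : ℕ) : R)) = wordSum z w' - wordSum z w := by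
          linear_combination h1
        rw [this]
        exact dvd_sub (dvd_wordSum _ _) (dvd_wordSum _ _)
      have hij : i = j := by
        fin_cases i <;> fin_cases j <;> simp at hd ⊢
        · exact hz (isUnit_of_dvd_one hd)
        · exact hz (isUnit_of_dvd_one hd)
      subst hij
      rw [ih w' (by simpa using hl) (add_right_cancel h1)]

theorem norm_wordSum_sub_le {z : ℂ} (hz : 1 < ‖z‖) (w : List (Fin 2)) :
    ∀ w' : List (Fin 2), w.length = w'.length →
      ‖wordSum z w - wordSum z w'‖ ≤ ‖z‖ * (‖z‖ ^ w.length - 1) / (‖z‖ - 1) := by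
  induction w using List.reverseRecOn with
  | nil =>
    intro w' hl
    rw [List.eq_nil_of_length_eq_zero hl.symm]
    simp
  | append_singleton w i ih =>
    intro w'
    cases w' using List.reverseRecOn with
    | nil => intro hl; simp at hl
    | append_singleton w' j =>
      intro hl
      have h1 := ih w' (by simpa using hl)
      have hij : ‖((i : ℕ) : ℂ) - ((j : ℕ) : ℂ)‖ ≤ 1 := by
        fin_cases i <;> fin_cases j <;> simp
      have hz' : ‖z‖ - 1 ≠ 0 := by linarith
      rw [wordSum_concat, wordSum_concat, ← mul_sub, norm_mul, add_sub_add_comm]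
      calc ‖z‖ * ‖wordSum z w - wordSum z w' + (((i : ℕ) : ℂ) - ((j : ℕ) : ℂ))‖
          ≤ ‖z‖ * (‖z‖ * (‖z‖ ^ w.length - 1) / (‖z‖ - 1) + 1) := by
            gcongr
            exact (norm_add_le _ _).trans (add_le_add h1 hij)
        _ = _ := by
            simp only [List.length_append, List.length_singleton]
            field_simp
            ring

open NumberField in
/-- Garsia's separation lemma in a number field: the norm of a nonzero algebraic integer is at
least `1` in absolute value, while all conjugates of the difference of two word sums other than the
one at `σ₀` are at most of the order of the `N`-th powers of the conjugates of `a`. -/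
theorem exists_separation_of_norm {K : Type*} [Field K] [NumberField K] (a : 𝓞 K)
    (ha : |Algebra.norm ℚ (a : K)| = 2) (hconj : ∀ σ : K →ₐ[ℚ] ℂ, 1 < ‖σ a‖)
    (σ₀ : K →ₐ[ℚ] ℂ) :
    ∃ c : ℝ, 0 < c ∧ ∀ w w' : List (Fin 2), w.length = w'.length → w ≠ w' →
      c * (‖σ₀ a‖ / 2) ^ w.length ≤ ‖wordSum (σ₀ a) w - wordSum (σ₀ a) w'‖ := by
  classical
  have hprod : ∀ x : K, ∏ σ : K →ₐ[ℚ] ℂ, ‖σ x‖ = ((|Algebra.norm ℚ x| : ℚ) : ℝ) := by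
    intro x
    have := Algebra.norm_eq_prod_embeddings ℚ ℂ x
    rw [← norm_prod, ← this]
    simp
  have hsplit : ∀ f : (K →ₐ[ℚ] ℂ) → ℝ,
      ∏ σ, f σ = f σ₀ * ∏ σ ∈ Finset.univ.erase σ₀, f σ := fun f =>
    (Finset.mul_prod_erase _ _ (Finset.mem_univ σ₀)).symm
  have ha0 : a ≠ 0 := by
    rintro rfl
    simp [Algebra.norm_zero] at ha
  have hunit : ¬ IsUnit a := by
    intro h
    rw [NumberField.isUnit_iff_norm, RingOfIntegers.coe_norm, ha] at h
    norm_num at h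
  set C : ℝ := ∏ σ ∈ Finset.univ.erase σ₀, ‖σ a‖ / (‖σ a‖ - 1) with hC
  have hCpos : 0 < C := Finset.prod_pos fun σ _ =>
    div_pos (by linarith [hconj σ]) (by linarith [hconj σ])
  set P : ℝ := ∏ σ ∈ Finset.univ.erase σ₀, ‖σ (a : K)‖ with hP
  have hPa : ‖σ₀ a‖ * P = 2 := by
    rw [← hsplit fun σ => ‖σ (a : K)‖, hprod, ha]; norm_num
  refine ⟨C⁻¹, inv_pos.2 hCpos, fun w w' hl hne => ?_⟩
  set N := w.length
  set d : 𝓞 K := wordSum a w - wordSum a w' with hd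
  have hd0 : d ≠ 0 := fun h => hne (eq_of_wordSum_eq ha0 hunit w w' hl (sub_eq_zero.1 h))
  have hσ : ∀ σ : K →ₐ[ℚ] ℂ, σ d = wordSum (σ a) w - wordSum (σ a) w' := by
    intro σ
    have := map_wordSum ((σ : K →+* ℂ).comp (algebraMap (𝓞 K) K)) a
    simp only [RingHom.comp_apply] at this
    simp only [hd, map_sub]
    exact congrArg₂ _ (this w) (this w')
  have h1 : (1 : ℝ) ≤ ∏ σ : K →ₐ[ℚ] ℂ, ‖σ (d : K)‖ := by
    rw [hprod, ← Algebra.coe_norm_int]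
    have : Algebra.norm ℤ d ≠ 0 := Algebra.norm_ne_zero_iff.2 hd0
    have := Int.one_le_abs this
    exact_mod_cast this
  have h2 : ∏ σ ∈ Finset.univ.erase σ₀, ‖σ (d : K)‖ ≤ C * P ^ N := by
    rw [hC, hP, ← Finset.prod_pow, ← Finset.prod_mul_distrib]
    refine Finset.prod_le_prod (fun _ _ => norm_nonneg _) fun σ _ => ?_
    have h := norm_wordSum_sub_le (hconj σ) w w' hl
    rw [hσ]
    refine h.trans ?_
    rw [div_mul_eq_mul_div]
    have := hconj σ
    gcongr
    · linarith
  have hPpow : ‖σ₀ a‖ / 2 = P⁻¹ := by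
    have : P ≠ 0 := by rintro h; rw [h] at hPa; norm_num at hPa
    field_simp
    linarith
  have hPpos : 0 < P := Finset.prod_pos fun σ _ => by linarith [hconj σ]
  rw [hsplit, hσ] at h1
  rw [hPpow, inv_pow, ← mul_inv, inv_le_iff_one_le_mul₀ (by positivity)]
  exact h1.trans (by gcongr)

/-- Garsia's separation lemma for a Garsia number `β`: the `2 ^ N` sums of words of length `N` lie
at distance at least a constant times `(β / 2) ^ N` from one another. -/
theorem IsGarsiaNumber.exists_separation {β : ℝ} (hβ : IsGarsiaNumber β) :
    ∃ c : ℝ, 0 < c ∧ ∀ w w' : List (Fin 2), w.length = w'.length → w ≠ w' →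
      c * (β / 2) ^ w.length ≤ |wordSum β w - wordSum β w'| := by
  obtain ⟨hI, hint, hnorm, hconj⟩ := hβ
  have hintQ : IsIntegral ℚ β := hint.tower_top
  have : FiniteDimensional ℚ (IntermediateField.adjoin ℚ {β}) :=
    IntermediateField.adjoin.finiteDimensional hintQ
  have : NumberField (IntermediateField.adjoin ℚ {β}) := ⟨⟩
  set K := IntermediateField.adjoin ℚ {β} with hK
  set g : K := IntermediateField.AdjoinSimple.gen ℚ β with hg
  have hgβ : algebraMap K ℝ g = β := IntermediateField.AdjoinSimple.algebraMap_gen ℚ β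
  have hgi : IsIntegral ℤ g := by
    rw [← isIntegral_algebraMap_iff (algebraMap K ℝ).injective, hgβ]
    exact hint
  let σ₀ : K →ₐ[ℚ] ℂ := ((Complex.ofRealAm).restrictScalars ℚ).comp (IsScalarTower.toAlgHom ℚ K ℝ)
  have hσ₀ : σ₀ g = (β : ℂ) := by
    rw [← hgβ]; rfl
  obtain ⟨c, hc, h⟩ := exists_separation_of_norm (⟨g, hgi⟩ : NumberField.RingOfIntegers K)
    (by rcases hnorm with h | h <;> (change |Algebra.norm ℚ g| = 2; rw [h]; norm_num))
    (fun σ => hconj _ (by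
      change IsConjRoot ℚ (β : ℂ) (σ g)
      rw [← hσ₀, IsConjRoot, minpoly.algHom_eq σ₀ σ₀.injective, minpoly.algHom_eq σ σ.injective]))
    σ₀
  refine ⟨c, hc, fun w w' hl hne => ?_⟩
  have h' := h w w' hl hne
  change c * (‖σ₀ g‖ / 2) ^ _ ≤ ‖wordSum (σ₀ g) w - wordSum (σ₀ g) w'‖ at h'
  have e : ∀ v, wordSum (β : ℂ) v = ((wordSum β v : ℝ) : ℂ) := fun v =>
    (map_wordSum Complex.ofRealHom β v).symm
  rw [hσ₀, e, e, ← Complex.ofReal_sub, Complex.norm_real, Complex.norm_real, Real.norm_eq_abs,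
    Real.norm_eq_abs, abs_of_pos (by linarith [hI.1])] at h'
  exact h'

/-! ### Expanding maps and the base interval -/

/-- The composition of the maps `y ↦ b * (y - i)` along the digits `i` of a word, the first digit
being applied first. -/
def expandWord (b : ℝ) (w : List (Fin 2)) (y : ℝ) : ℝ :=
  w.foldl (fun y (i : Fin 2) => b * (y - ((i : ℕ) : ℝ))) y

theorem expandWord_append (b : ℝ) (u v : List (Fin 2)) (y : ℝ) :
    expandWord b (u ++ v) y = expandWord b v (expandWord b u y) := by
  simp [expandWord]

theorem expandWord_eq (b : ℝ) (w : List (Fin 2)) (y : ℝ) :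
    expandWord b w y = b ^ w.length * y - wordSum b w := by
  induction w generalizing y with
  | nil => simp [expandWord, wordSum]
  | cons i w ih =>
    change expandWord b w (b * (y - ((i : ℕ) : ℝ))) = _
    rw [ih, wordSum_cons, List.length_cons]
    ring

/-- The interval `[0, b / (b - 1)]`, which is `[0, 1 / (1 - l)]` for `l = b⁻¹`. -/
def baseInterval (b : ℝ) : Set ℝ := Set.Icc 0 (b / (b - 1))

theorem measurableSet_baseInterval (b : ℝ) : MeasurableSet (baseInterval b) := measurableSet_Icc

theorem mem_baseInterval_of_step {b : ℝ} (hb : 1 < b) (i : Fin 2) {y : ℝ}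
    (h : b * (y - ((i : ℕ) : ℝ)) ∈ baseInterval b) : y ∈ baseInterval b := by
  obtain ⟨h0, h1⟩ := h
  have hb1 : 0 < b - 1 := by linarith
  have hi0 : (0 : ℝ) ≤ ((i : ℕ) : ℝ) := Nat.cast_nonneg _
  have hi1 : ((i : ℕ) : ℝ) ≤ 1 := by fin_cases i <;> simp
  have h0' : 0 ≤ y - ((i : ℕ) : ℝ) := nonneg_of_mul_nonneg_right h0 (by linarith)
  have h1' : y - ((i : ℕ) : ℝ) ≤ 1 / (b - 1) := by
    rw [show b / (b - 1) = b * (1 / (b - 1)) by ring] at h1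
    exact le_of_mul_le_mul_left h1 (by linarith)
  have : b / (b - 1) = 1 + 1 / (b - 1) := by field_simp; ring
  exact ⟨by linarith, by linarith⟩

theorem mem_baseInterval_of_expandWord {b : ℝ} (hb : 1 < b) (w : List (Fin 2)) {y : ℝ}
    (h : expandWord b w y ∈ baseInterval b) : y ∈ baseInterval b := by
  induction w generalizing y with
  | nil => exact h
  | cons i w ih => exact mem_baseInterval_of_step hb i (ih h)

theorem exists_step_mem_baseInterval {b : ℝ} (hb : 1 < b) (hb2 : b ≤ 2) {y : ℝ}
    (h : y ∈ baseInterval b) : ∃ i : Fin 2, b * (y - ((i : ℕ) : ℝ)) ∈ baseInterval b := by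
  obtain ⟨h0, h1⟩ := h
  have hb1 : 0 < b - 1 := by linarith
  have hb0 : 0 < b := by linarith
  have e : b / (b - 1) = 1 + 1 / (b - 1) := by field_simp; ring
  have e' : b / (b - 1) = b * (1 / (b - 1)) := by ring
  by_cases hy : y < 1
  · refine ⟨0, by simpa using (mul_nonneg hb0.le h0), ?_⟩
    have : (1 : ℝ) ≤ 1 / (b - 1) := by rw [le_div_iff₀ hb1]; linarith
    rw [e']
    exact mul_le_mul_of_nonneg_left (by
      simp only [Fin.val_zero, Nat.cast_zero, sub_zero]; linarith) hb0.le
  · refine ⟨1, mul_nonneg hb0.le (by simpa using hy), ?_⟩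
    rw [e']
    exact mul_le_mul_of_nonneg_left (by
      simp only [Fin.val_one, Nat.cast_one]; linarith) hb0.le

theorem exists_expandWord_mem {b : ℝ} (hb : 1 < b) (hb2 : b ≤ 2) (k : ℕ) {y : ℝ}
    (h : y ∈ baseInterval b) :
    ∃ u : List (Fin 2), u.length = k ∧ expandWord b u y ∈ baseInterval b := by
  induction k generalizing y with
  | zero => exact ⟨[], rfl, h⟩
  | succ k ih =>
    obtain ⟨i, hi⟩ := exists_step_mem_baseInterval hb hb2 h
    obtain ⟨u, hu, hu'⟩ := ih hi
    exact ⟨i :: u, by simp [hu], hu'⟩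

theorem abs_sub_le_of_expandWord_mem {b : ℝ} (hb : 1 < b) (u : List (Fin 2)) {x y : ℝ}
    (hx : expandWord b u x ∈ baseInterval b) (hy : expandWord b u y ∈ baseInterval b) :
    |x - y| ≤ (b ^ u.length)⁻¹ * (b / (b - 1)) := by
  have hpos : 0 < b ^ u.length := by positivity
  rw [inv_mul_eq_div, le_div_iff₀ hpos]
  nth_rw 1 [← abs_of_pos hpos]
  rw [← abs_mul]
  rw [expandWord_eq] at hx hy
  obtain ⟨h1, h2⟩ := hx
  obtain ⟨h3, h4⟩ := hy
  rw [abs_le]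
  constructor <;> nlinarith

/-! ### Finite words and cover counts -/

/-- The words of length `n` over `{0, 1}`. -/
def binaryWords : ℕ → Finset (List (Fin 2))
  | 0 => {[]}
  | n + 1 => Finset.univ.biUnion fun i : Fin 2 => (binaryWords n).image (List.cons i)

theorem mem_binaryWords {n : ℕ} {w : List (Fin 2)} : w ∈ binaryWords n ↔ w.length = n := by
  induction n generalizing w with
  | zero => simp [binaryWords]
  | succ n ih => cases w <;> simp [binaryWords, ih]

theorem sum_binaryWords_succ {M : Type*} [AddCommMonoid M] (n : ℕ) (f : List (Fin 2) → M) :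
    ∑ w ∈ binaryWords (n + 1), f w = ∑ i : Fin 2, ∑ w ∈ binaryWords n, f (i :: w) := by
  rw [binaryWords, Finset.sum_biUnion]
  · refine Finset.sum_congr rfl fun i _ => Finset.sum_image fun a _ b _ h => ?_
    simpa using h
  · intro i _ j _ hij
    simp only [Function.onFun]
    rw [Finset.disjoint_left]
    intro w hw hw'
    simp only [Finset.mem_image] at hw hw'
    obtain ⟨a, -, rfl⟩ := hw
    obtain ⟨c, -, hc⟩ := hw'
    exact hij (by simpa using (congrArg List.head? hc).symm)

theorem sum_binaryWords_add {M : Type*} [AddCommMonoid M] (k m : ℕ) (f : List (Fin 2) → M) :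
    ∑ w ∈ binaryWords (k + m), f w = ∑ u ∈ binaryWords k, ∑ v ∈ binaryWords m, f (u ++ v) := by
  induction k generalizing f with
  | zero => simp [binaryWords]
  | succ k ih =>
    rw [add_right_comm, sum_binaryWords_succ, sum_binaryWords_succ]
    exact Finset.sum_congr rfl fun i _ => ih _

theorem card_binaryWords (n : ℕ) : (binaryWords n).card = 2 ^ n := by
  induction n with
  | zero => simp [binaryWords]
  | succ n ih =>
    have := sum_binaryWords_succ n fun _ => 1
    simp only [Finset.sum_const, ih, Finset.card_univ, Fintype.card_fin, smul_eq_mul,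
      mul_one] at this
    rw [this]; ring

/-- The number of words `u` of length `k` with `y ∈ S_u (X)`, where `X` is the base interval and
`S_u` is the inverse of `expandWord b u`. -/
noncomputable def coverCount (b : ℝ) (k : ℕ) (y : ℝ) : ℝ :=
  ∑ u ∈ binaryWords k, (baseInterval b).indicator 1 (expandWord b u y)

theorem coverCount_succ (b : ℝ) (k : ℕ) (y : ℝ) :
    coverCount b (k + 1) y = ∑ i : Fin 2, coverCount b k (b * (y - ((i : ℕ) : ℝ))) := by
  rw [coverCount, sum_binaryWords_succ]
  rfl

theorem coverCount_nonneg (b : ℝ) (k : ℕ) (y : ℝ) : 0 ≤ coverCount b k y :=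
  Finset.sum_nonneg fun _ _ => Set.indicator_nonneg (fun _ _ => zero_le_one) _

theorem integral_coverCount {b : ℝ} (hb : 1 < b) (k : ℕ) :
    Integrable (coverCount b k) ∧ ∫ y, coverCount b k y = (2 / b) ^ k * (b / (b - 1)) := by
  have hb0 : b ≠ 0 := by linarith
  induction k with
  | zero =>
    have : coverCount b 0 = (baseInterval b).indicator 1 := by
      funext y; simp [coverCount, binaryWords, expandWord]
    rw [this]
    refine ⟨(integrable_indicator_iff (measurableSet_baseInterval b)).2
      (by rw [baseInterval]; exact integrableOn_const (by simp)), ?_⟩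
    rw [integral_indicator_one (measurableSet_baseInterval b), baseInterval,
      Real.volume_real_Icc_of_le (by apply div_nonneg <;> linarith)]
    simp
  | succ k ih =>
    have hint : ∀ i : Fin 2, Integrable fun y => coverCount b k (b * (y - ((i : ℕ) : ℝ))) :=
      fun i => (ih.1.comp_mul_left' hb0).comp_sub_right _
    have e : coverCount b (k + 1) =
        fun y => ∑ i : Fin 2, coverCount b k (b * (y - ((i : ℕ) : ℝ))) :=
      funext (coverCount_succ b k)
    refine ⟨e ▸ integrable_finsetSum _ fun i _ => hint i, ?_⟩
    rw [e, integral_finsetSum _ fun i _ => hint i]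
    have : ∀ i : Fin 2, ∫ y, coverCount b k (b * (y - ((i : ℕ) : ℝ))) =
        b⁻¹ * ((2 / b) ^ k * (b / (b - 1))) := by
      intro i
      rw [integral_sub_right_eq_self (fun y => coverCount b k (b * y)),
        Measure.integral_comp_mul_left, ih.2, abs_of_pos (by positivity), smul_eq_mul]
    simp only [this, Finset.sum_const, Finset.card_univ, Fintype.card_fin, nsmul_eq_mul]
    rw [pow_succ]; push_cast; ring

theorem measurable_coverCount (b : ℝ) (k : ℕ) : Measurable (coverCount b k) := by
  induction k with
  | zero =>
    have : coverCount b 0 = (baseInterval b).indicator 1 := by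
      funext y; simp [coverCount, binaryWords, expandWord]
    rw [this]
    exact measurable_one.indicator (measurableSet_baseInterval b)
  | succ k ih =>
    rw [funext (coverCount_succ b k)]
    fun_prop

open Classical in
theorem coverCount_eq_card (b : ℝ) (k : ℕ) (y : ℝ) : coverCount b k y =
    ((binaryWords k).filter fun u => expandWord b u y ∈ baseInterval b).card := by
  simp [coverCount, Set.indicator_apply, Finset.sum_boole]

/-- A `d`-separated family of points in an interval of length `L` has at most `L / d + 1`
members. -/
theorem card_le_of_separated {ι : Type*} (s : Finset ι) (f : ι → ℝ) {d a L : ℝ} (hd : 0 < d)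
    (hL : 0 ≤ L) (hsep : ∀ i ∈ s, ∀ j ∈ s, i ≠ j → d ≤ |f i - f j|)
    (hmem : ∀ i ∈ s, f i ∈ Set.Icc a (a + L)) : (s.card : ℝ) ≤ L / d + 1 := by
  have h : s.card ≤ (Finset.range (⌊L / d⌋₊ + 1)).card := by
    refine Finset.card_le_card_of_injOn (fun i => ⌊(f i - a) / d⌋₊) (fun i hi => ?_)
      fun i hi j hj hij => ?_
    · have := hmem i hi
      simp only [Finset.coe_range, Set.mem_Iio, Nat.lt_succ_iff]
      apply Nat.floor_le_floor
      gcongr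
      linarith [this.2]
    · by_contra hne
      have h1 := hsep i hi j hj hne
      have hn : ∀ i ∈ s, 0 ≤ (f i - a) / d := fun i hi =>
        div_nonneg (by linarith [(hmem i hi).1]) hd.le
      have hij' : ⌊(f i - a) / d⌋₊ = ⌊(f j - a) / d⌋₊ := hij
      have a1 := Nat.floor_le (hn i hi)
      have a2 := Nat.lt_floor_add_one ((f i - a) / d)
      have b1 := Nat.floor_le (hn j hj)
      have b2 := Nat.lt_floor_add_one ((f j - a) / d)
      rw [hij'] at a1 a2
      have : |(f i - a) / d - (f j - a) / d| < 1 := by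
        rw [abs_lt]; constructor <;> linarith
      rw [← sub_div, sub_sub_sub_cancel_right, abs_div, abs_of_pos hd, div_lt_one hd] at this
      linarith
  rw [Finset.card_range] at h
  calc (s.card : ℝ) ≤ (⌊L / d⌋₊ : ℝ) + 1 := by exact_mod_cast h
    _ ≤ _ := by gcongr; exact Nat.floor_le (by positivity)

theorem coverCount_le {b c : ℝ} (hb : 1 < b) (hb2 : b < 2) (hc : 0 < c)
    (hsep : ∀ w w' : List (Fin 2), w.length = w'.length → w ≠ w' →
      c * (b / 2) ^ w.length ≤ |wordSum b w - wordSum b w'|) (k : ℕ) (y : ℝ) :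
    coverCount b k y ≤ (b / (b - 1) / c + 1) * (2 / b) ^ k := by
  classical
  rw [coverCount_eq_card]
  have hX : 0 ≤ b / (b - 1) := div_nonneg (by linarith) (by linarith)
  refine (card_le_of_separated (d := c * (b / 2) ^ k) (a := b ^ k * y - b / (b - 1))
    (L := b / (b - 1)) _ (wordSum b) (by positivity) hX ?_ ?_).trans ?_
  · intro u hu v hv hne
    simp only [Finset.mem_filter, mem_binaryWords] at hu hv
    rw [← hu.1]
    exact hsep u v (hu.1.trans hv.1.symm) hne
  · intro u hu
    simp only [Finset.mem_filter, mem_binaryWords] at hu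
    obtain ⟨h1, h2, h3⟩ := hu
    rw [expandWord_eq, h1] at h2 h3
    constructor <;> linarith
  · have h1 : 1 ≤ (2 / b) ^ k := one_le_pow₀ (by rw [le_div_iff₀] <;> linarith)
    have h2 : b / (b - 1) / (c * (b / 2) ^ k) = b / (b - 1) / c * (2 / b) ^ k := by
      rw [← div_div, ← inv_div b 2, inv_pow]; rfl
    rw [h2, add_mul, one_mul]
    gcongr

/-! ### Positive cover density almost everywhere -/

/-- Lebesgue's density theorem: near almost every point of a measurable set, the complement has
arbitrarily small density. -/
theorem ae_eventually_measureReal_diff_le {A : Set ℝ} (hA : MeasurableSet A) :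
    ∀ᵐ y, y ∈ A → ∀ ε > 0, ∀ᶠ r in 𝓝[>] (0 : ℝ),
      volume.real (Metric.closedBall y r \ A) ≤ ε * r := by
  have h := Besicovitch.ae_tendsto_measure_inter_div (volume : Measure ℝ) A
  rw [ae_restrict_iff' hA] at h
  filter_upwards [h] with y hy hyA ε hε
  have h1 := (ENNReal.tendsto_toReal ENNReal.one_ne_top).comp (hy hyA)
  have h2 := h1.eventually (lt_mem_nhds (show (1 : ENNReal).toReal - ε / 2 < (1 : ENNReal).toReal
    by linarith))
  filter_upwards [h2, self_mem_nhdsWithin] with r hr hr0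
  have hr0' : 0 < r := hr0
  simp only [Function.comp_apply, ENNReal.toReal_div, ENNReal.toReal_one, Set.inter_comm A] at hr
  have hv : (volume (Metric.closedBall y r)).toReal = 2 * r := by
    rw [Real.volume_closedBall, ENNReal.toReal_ofReal (by linarith)]
  rw [hv, lt_div_iff₀ (by linarith)] at hr
  have := measureReal_inter_add_sdiff (μ := (volume : Measure ℝ)) (s := Metric.closedBall y r) hA
    measure_closedBall_lt_top.ne
  simp only [measureReal_def] at this ⊢
  rw [hv] at this
  nlinarith

/-- The points at which the normalised numbers of covers tend to `0` form a set that is mapped into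
itself by the expanding maps. -/
theorem tendsto_coverCount_step {b : ℝ} (hb : 1 < b) {y : ℝ}
    (h : Tendsto (fun k => coverCount b k y / (2 / b) ^ k) atTop (𝓝 0)) (i : Fin 2) :
    Tendsto (fun k => coverCount b k (b * (y - ((i : ℕ) : ℝ))) / (2 / b) ^ k) atTop (𝓝 0) := by
  have h1 := ((tendsto_add_atTop_iff_nat 1).2 h).const_mul (2 / b)
  rw [mul_zero] at h1
  have hb0 : 0 < b := by linarith
  refine squeeze_zero (fun k => div_nonneg (coverCount_nonneg _ _ _) (by positivity))
    (fun k => ?_) h1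
  have : 2 / b * (coverCount b (k + 1) y / (2 / b) ^ (k + 1)) =
      coverCount b (k + 1) y / (2 / b) ^ k := by
    rw [pow_succ]; field_simp
  rw [this, coverCount_succ]
  gcongr
  exact Finset.single_le_sum (f := fun j : Fin 2 => coverCount b k (b * (y - ((j : ℕ) : ℝ))))
    (fun j _ => coverCount_nonneg _ _ _) (Finset.mem_univ i)

theorem tendsto_coverCount_expandWord {b : ℝ} (hb : 1 < b) (w : List (Fin 2)) {y : ℝ}
    (h : Tendsto (fun k => coverCount b k y / (2 / b) ^ k) atTop (𝓝 0)) :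
    Tendsto (fun k => coverCount b k (expandWord b w y) / (2 / b) ^ k) atTop (𝓝 0) := by
  induction w generalizing y with
  | nil => exact h
  | cons i w ih => exact ih (tendsto_coverCount_step hb h i)

/-- A zero-one law: a set mapped into itself by the expanding maps is null or co-null in the base
interval, because blowing it up at a density point fills the interval. -/
theorem measure_diff_eq_zero_of_invariant {b : ℝ} (hb : 1 < b) (hb2 : b ≤ 2) {Z : Set ℝ}
    (hZ : MeasurableSet Z) (hinv : ∀ w : List (Fin 2), ∀ y ∈ Z, expandWord b w y ∈ Z)
    (hpos : volume (baseInterval b ∩ Z) ≠ 0) : volume (baseInterval b \ Z) = 0 := by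
  have hb0 : 0 < b := by linarith
  have hXpos : 0 < b / (b - 1) := div_pos hb0 (by linarith)
  obtain ⟨y, ⟨hyX, hyZ⟩, hy⟩ : ∃ y ∈ baseInterval b ∩ Z, ∀ ε > 0, ∀ᶠ r in 𝓝[>] (0 : ℝ),
      volume.real (Metric.closedBall y r \ Z) ≤ ε * r := by
    by_contra! hcon
    refine hpos (measure_mono_null ?_ (ae_iff.1 (ae_eventually_measureReal_diff_le hZ)))
    intro y hy h
    obtain ⟨ε, hε, h'⟩ := hcon y hy
    obtain ⟨r, hr, hr'⟩ := (h'.and_eventually (h hy.2 ε hε)).exists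
    exact absurd hr' (not_le.2 hr)
  have hfin : volume (baseInterval b \ Z) ≠ ⊤ :=
    ne_top_of_le_ne_top (by simp [baseInterval]) (measure_mono Set.sdiff_subset)
  suffices h : volume.real (baseInterval b \ Z) ≤ 0 by
    have := le_antisymm h measureReal_nonneg
    rwa [measureReal_eq_zero_iff hfin] at this
  refine le_of_forall_pos_le_add fun ε hε => ?_
  rw [zero_add]
  have hr : Tendsto (fun k : ℕ => (b ^ k)⁻¹ * (b / (b - 1))) atTop (𝓝[>] 0) := by
    refine tendsto_nhdsWithin_iff.2 ⟨?_, Eventually.of_forall fun k => ?_⟩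
    · have := (tendsto_inv_atTop_zero.comp (tendsto_pow_atTop_atTop_of_one_lt hb)).mul_const
        (b / (b - 1))
      simpa using this
    · exact mul_pos (by positivity) hXpos
  obtain ⟨k, hk⟩ := (hr.eventually (hy (ε / (b / (b - 1))) (by positivity))).exists
  obtain ⟨u, rfl, hu⟩ := exists_expandWord_mem hb hb2 k hyX
  set g : ℝ → ℝ := fun z => (b ^ u.length)⁻¹ * (z + wordSum b u) with hg
  have hbk : (0 : ℝ) < b ^ u.length := by positivity
  have hgu : ∀ z, expandWord b u (g z) = z := by
    intro z
    rw [expandWord_eq, hg]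
    field_simp
    ring
  have hsub : g '' (baseInterval b \ Z) ⊆
      Metric.closedBall y ((b ^ u.length)⁻¹ * (b / (b - 1))) \ Z := by
    rintro _ ⟨z, ⟨hzX, hzZ⟩, rfl⟩
    refine ⟨?_, fun h => hzZ (by simpa [hgu] using hinv u _ h)⟩
    rw [Metric.mem_closedBall, Real.dist_eq]
    exact abs_sub_le_of_expandWord_mem hb u (by rwa [hgu]) hu
  have hvol : volume.real (g '' (baseInterval b \ Z)) =
      (b ^ u.length)⁻¹ * volume.real (baseInterval b \ Z) := by
    have hinvg : ∀ z, g (expandWord b u z) = z := by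
      intro z
      rw [expandWord_eq, hg]
      field_simp
      ring
    have : g '' (baseInterval b \ Z) = (fun x => b ^ u.length * x) ⁻¹'
        ((fun x => x + -wordSum b u) ⁻¹' (baseInterval b \ Z)) := by
      rw [Set.image_eq_preimage_of_inverse hgu hinvg, ← Set.preimage_comp]
      congr 1
      funext x
      rw [expandWord_eq]
      rfl
    rw [this, measureReal_def, Real.volume_preimage_mul_left hbk.ne', measure_preimage_add_right,
      ENNReal.toReal_mul, ENNReal.toReal_ofReal (by positivity), abs_of_pos (by positivity)]
    rfl
  have h1 := measureReal_mono (μ := volume) hsub (ne_top_of_le_ne_top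
    measure_closedBall_lt_top.ne (measure_mono Set.sdiff_subset))
  rw [hvol] at h1
  have h2 := h1.trans hk
  rw [show ε / (b / (b - 1)) * ((b ^ u.length)⁻¹ * (b / (b - 1))) = (b ^ u.length)⁻¹ * ε by
    rw [mul_left_comm, div_mul_cancel₀ _ hXpos.ne']] at h2
  exact le_of_mul_le_mul_left h2 (by positivity)

/-- Almost every point of the base interval is covered, for infinitely many `k`, by a positive
proportion of the expected number of sets `S_u (X)` with `u` of length `k`. -/
theorem ae_exists_frequently_le_coverCount {b c : ℝ} (hb : 1 < b) (hb2 : b < 2) (hc : 0 < c)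
    (hsep : ∀ w w' : List (Fin 2), w.length = w'.length → w ≠ w' →
      c * (b / 2) ^ w.length ≤ |wordSum b w - wordSum b w'|) :
    ∀ᵐ y, y ∈ baseInterval b →
      ∃ δ > 0, ∃ᶠ k in atTop, δ ≤ coverCount b k y / (2 / b) ^ k := by
  have hb0 : 0 < b := by linarith
  set Z : Set ℝ := {y | Tendsto (fun k => coverCount b k y / (2 / b) ^ k) atTop (𝓝 0)} with hZdef
  have hZ : MeasurableSet Z := measurableSet_tendsto _ fun k =>
    (measurable_coverCount b k).div_const _
  have hnull : volume (baseInterval b ∩ Z) = 0 := by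
    by_contra hpos
    have h0 := measure_diff_eq_zero_of_invariant hb hb2.le hZ
      (fun w y hy => tendsto_coverCount_expandWord hb w hy) hpos
    have hsupp : ∀ k, ∀ y ∉ baseInterval b, coverCount b k y / (2 / b) ^ k = 0 := by
      intro k y hy
      rw [coverCount, Finset.sum_eq_zero, zero_div]
      intro u _
      exact Set.indicator_of_notMem (fun h => hy (mem_baseInterval_of_expandWord hb u h)) _
    have hlim := tendsto_integral_of_dominated_convergence (μ := volume)
      (F := fun k y => coverCount b k y / (2 / b) ^ k) (f := fun _ => 0)
      ((baseInterval b).indicator fun _ => b / (b - 1) / c + 1)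
      (fun k => ((measurable_coverCount b k).div_const _).aestronglyMeasurable)
      ((integrable_indicator_iff (measurableSet_baseInterval b)).2
        (integrableOn_const (by simp [baseInterval])))
      (fun k => Eventually.of_forall fun y => by
        by_cases hy : y ∈ baseInterval b
        · rw [Set.indicator_of_mem hy, Real.norm_of_nonneg
            (div_nonneg (coverCount_nonneg _ _ _) (by positivity)), div_le_iff₀ (by positivity)]
          exact coverCount_le hb hb2 hc hsep k y
        · simp only [hsupp k y hy, Set.indicator_of_notMem hy, norm_zero, le_refl])
      (by
        have : ∀ᵐ y, y ∉ baseInterval b \ Z := measure_eq_zero_iff_ae_notMem.1 h0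
        filter_upwards [this] with y hy
        by_cases hyX : y ∈ baseInterval b
        · by_contra hyZ
          exact hy ⟨hyX, hyZ⟩
        · simp only [hsupp _ y hyX, tendsto_const_nhds_iff])
    have hconst : ∀ k, ∫ y, coverCount b k y / (2 / b) ^ k = b / (b - 1) := by
      intro k
      rw [integral_div, (integral_coverCount hb k).2]
      field_simp
    simp only [hconst, integral_zero, tendsto_const_nhds_iff] at hlim
    have : 0 < b / (b - 1) := div_pos hb0 (by linarith)
    linarith
  filter_upwards [measure_eq_zero_iff_ae_notMem.1 hnull] with y hy hyX
  by_contra! hcon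
  refine hy ⟨hyX, ?_⟩
  rw [hZdef, Set.mem_ofPred_eq, tendsto_order]
  refine ⟨fun a ha => Eventually.of_forall fun k =>
    ha.trans_le (div_nonneg (coverCount_nonneg _ _ _) (by positivity)), fun a ha => ?_⟩
  simpa using hcon a ha

/-! ### A second moment estimate -/

/-- A second moment bound for the measure of a finite union, with a free parameter `t`. It follows
by integrating `2 * t * F ≤ t ^ 2 * 1 + F ^ 2` over the union, where `F` counts the sets containing
a point. -/
theorem two_mul_sum_measureReal_le {α ι : Type*} [MeasurableSpace α] (μ : Measure α)
    (J : Finset ι) (B : ι → Set α) (hB : ∀ a ∈ J, MeasurableSet (B a))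
    (hfin : ∀ a ∈ J, μ (B a) ≠ ⊤) (t : ℝ) :
    2 * t * ∑ a ∈ J, μ.real (B a) ≤
      t ^ 2 * μ.real (⋃ a ∈ J, B a) + ∑ a ∈ J, ∑ b ∈ J, μ.real (B a ∩ B b) := by
  have hU : MeasurableSet (⋃ a ∈ J, B a) := Finset.measurableSet_biUnion J hB
  have hUfin : μ (⋃ a ∈ J, B a) ≠ ⊤ :=
    (measure_biUnion_lt_top J.finite_toSet fun a ha => (hfin a ha).lt_top).ne
  have hint : ∀ s : Set α, MeasurableSet s → μ s ≠ ⊤ →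
      Integrable (s.indicator (1 : α → ℝ)) μ := fun s hs hsf =>
    (integrable_indicator_iff hs).2 (integrableOn_const hsf)
  have hI : ∀ a ∈ J, ∀ b ∈ J, Integrable ((B a ∩ B b).indicator (1 : α → ℝ)) μ := fun a ha b hb =>
    hint _ ((hB a ha).inter (hB b hb))
      (ne_top_of_le_ne_top (hfin a ha) (measure_mono Set.inter_subset_left))
  have e1 : ∑ a ∈ J, μ.real (B a) = ∫ x, ∑ a ∈ J, (B a).indicator (1 : α → ℝ) x ∂μ := by
    rw [integral_finsetSum _ fun a ha => hint _ (hB a ha) (hfin a ha)]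
    exact Finset.sum_congr rfl fun a ha => (integral_indicator_one (hB a ha)).symm
  have e2 : ∑ a ∈ J, ∑ b ∈ J, μ.real (B a ∩ B b) =
      ∫ x, ∑ a ∈ J, ∑ b ∈ J, (B a ∩ B b).indicator (1 : α → ℝ) x ∂μ := by
    rw [integral_finsetSum _ fun a ha => integrable_finsetSum _ fun b hb => hI a ha b hb]
    refine Finset.sum_congr rfl fun a ha => ?_
    rw [integral_finsetSum _ fun b hb => hI a ha b hb]
    exact Finset.sum_congr rfl fun b hb =>
      (integral_indicator_one ((hB a ha).inter (hB b hb))).symm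
  rw [e1, e2, ← integral_indicator_one hU, ← integral_const_mul, ← integral_const_mul,
    ← integral_add ((hint _ hU hUfin).const_mul _)
      (integrable_finsetSum _ fun a ha => integrable_finsetSum _ fun b hb => hI a ha b hb)]
  refine integral_mono ((integrable_finsetSum _ fun a ha =>
    hint _ (hB a ha) (hfin a ha)).const_mul _) (((hint _ hU hUfin).const_mul _).add
      (integrable_finsetSum _ fun a ha => integrable_finsetSum _ fun b hb => hI a ha b hb))
    fun x => ?_
  have e3 : ∑ a ∈ J, ∑ b ∈ J, (B a ∩ B b).indicator (1 : α → ℝ) x =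
      (∑ a ∈ J, (B a).indicator (1 : α → ℝ) x) ^ 2 := by
    rw [sq, Finset.sum_mul_sum]
    refine Finset.sum_congr rfl fun a _ => Finset.sum_congr rfl fun b _ => ?_
    rw [Set.inter_indicator_one, Pi.mul_apply]
  simp only [e3]
  by_cases hx : x ∈ ⋃ a ∈ J, B a
  · rw [Set.indicator_of_mem hx, Pi.one_apply]
    nlinarith [sq_nonneg (t - ∑ a ∈ J, (B a).indicator (1 : α → ℝ) x)]
  · have : ∑ a ∈ J, (B a).indicator (1 : α → ℝ) x = 0 :=
      Finset.sum_eq_zero fun a ha => Set.indicator_of_notMem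
        (fun h => hx (Set.mem_biUnion ha h)) _
    simp [this, Set.indicator_of_notMem hx]

/-- A ball of radius `r` meets few members of a separated family of balls of radius `r'`. -/
theorem sum_measureReal_ball_inter_le {ι : Type*} (V : Finset ι) (p : ι → ℝ) {d r r' : ℝ}
    (hd : 0 < d) (hr : 0 ≤ r) (hr' : 0 ≤ r')
    (hsep : ∀ i ∈ V, ∀ j ∈ V, i ≠ j → d ≤ |p i - p j|) (x : ℝ) :
    ∑ i ∈ V, volume.real (Metric.ball x r ∩ Metric.ball (p i) r') ≤
      (2 * (r + r') / d + 1) * (2 * r') := by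
  classical
  have h1 : ∀ i ∈ V, volume.real (Metric.ball x r ∩ Metric.ball (p i) r') ≤
      if |p i - x| ≤ r + r' then 2 * r' else 0 := by
    intro i _
    split_ifs with h
    · refine (measureReal_mono Set.inter_subset_right measure_ball_lt_top.ne).trans ?_
      rw [Real.volume_real_ball hr']
    · have : Metric.ball x r ∩ Metric.ball (p i) r' = ∅ := by
        rw [← Set.disjoint_iff_inter_eq_empty]
        apply Metric.ball_disjoint_ball
        rw [dist_comm, Real.dist_eq]
        exact (not_le.1 h).le
      simp [this]
  refine (Finset.sum_le_sum h1).trans ?_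
  rw [← Finset.sum_filter, Finset.sum_const, nsmul_eq_mul]
  gcongr
  refine card_le_of_separated (a := x - (r + r')) _ p hd (by positivity)
    (fun i hi j hj => hsep i (Finset.mem_filter.1 hi).1 j (Finset.mem_filter.1 hj).1) ?_
  intro i hi
  have := abs_le.1 (Finset.mem_filter.1 hi).2
  constructor <;> linarith

theorem sum_filter_two_pow_div_le (I : Finset ℕ) (N : ℕ) :
    ∑ M ∈ I, (if M ≤ N then (2 : ℝ) ^ M / 2 ^ N else 0) ≤ 2 := by
  rw [← Finset.sum_filter, ← Finset.sum_div, div_le_iff₀ (by positivity)]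
  have h1 : ∑ M ∈ I with M ≤ N, (2 : ℝ) ^ M ≤ ∑ M ∈ Finset.range (N + 1), (2 : ℝ) ^ M := by
    refine Finset.sum_le_sum_of_subset_of_nonneg (fun M hM => ?_) fun _ _ _ => by positivity
    have := (Finset.mem_filter.1 hM).2
    simp only [Finset.mem_range]; omega
  refine h1.trans ?_
  rw [geom_sum_eq (by norm_num), pow_succ]
  linarith

/-- For each `N` in a finite set let `m * 2 ^ N` points be given that are `d / 2 ^ N`-separated.
If the numbers `η N ≤ 1` have sum at least `1`, then the balls of radii `η N / 2 ^ N` about these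
points cover a set of measure at least a constant multiple of `m`. -/
theorem measureReal_iUnion_ball_ge {ι : Type*} (I : Finset ℕ) (V : ℕ → Finset ι)
    (p : ι → ℝ) (η : ℕ → ℝ) {d m : ℝ} (hd : 0 < d) (hm : 0 ≤ m)
    (hη : ∀ N, 0 ≤ η N) (hη1 : ∀ N, η N ≤ 1)
    (hcard : ∀ N ∈ I, ((V N).card : ℝ) = m * 2 ^ N)
    (hsep : ∀ N ∈ I, ∀ i ∈ V N, ∀ j ∈ V N, i ≠ j → d / 2 ^ N ≤ |p i - p j|)
    (hsum : 1 ≤ ∑ N ∈ I, η N) :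
    2 * m / (4 + 10 / d) ≤
      volume.real (⋃ N ∈ I, ⋃ i ∈ V N, Metric.ball (p i) (η N / 2 ^ N)) := by
  set H := ∑ N ∈ I, η N with hH
  set r : ℕ → ℝ := fun N => η N / 2 ^ N with hr
  have hr0 : ∀ N, 0 ≤ r N := fun N => div_nonneg (hη N) (by positivity)
  set a : ℕ → ℕ → ℝ := fun M N => η N * if M ≤ N then (2 : ℝ) ^ M / 2 ^ N else 0 with ha
  have ha0 : ∀ M N, 0 ≤ a M N := fun M N => by
    have := hη N
    simp only [ha]; split_ifs <;> positivity
  set g : ℕ → ℕ → ℝ := fun M N => ∑ i ∈ V M, ∑ j ∈ V N,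
    volume.real (Metric.ball (p i) (r M) ∩ Metric.ball (p j) (r N)) with hg
  have hgsymm : ∀ M N, g M N = g N M := fun M N => by
    simp only [hg]
    rw [Finset.sum_comm]
    simp only [Set.inter_comm]
  have hle : ∀ M ∈ I, ∀ N ∈ I, M ≤ N →
      g M N ≤ 2 * m * ((1 + 2 / d) * a M N + 2 / d * (η M * η N)) := by
    intro M hM N hN hMN
    have h1 : g M N ≤ ∑ _i ∈ V M, (2 * (r M + r N) / (d / 2 ^ N) + 1) * (2 * r N) :=
      Finset.sum_le_sum fun i _ =>
        sum_measureReal_ball_inter_le (V N) p (by positivity) (hr0 M) (hr0 N) (hsep N hN) (p i)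
    rw [Finset.sum_const, nsmul_eq_mul, hcard M hM] at h1
    refine h1.trans ?_
    simp only [ha, hr, if_pos hMN]
    have h2 : m * 2 ^ M * ((2 * (η M / 2 ^ M + η N / 2 ^ N) / (d / 2 ^ N) + 1) *
        (2 * (η N / 2 ^ N))) = 2 * m * ((1 + 2 / d * η N) * (η N * (2 ^ M / 2 ^ N)) +
          2 / d * (η M * η N)) := by
      field_simp
      ring
    rw [h2]
    have := hη N
    gcongr
    exact mul_le_of_le_one_right (by positivity) (hη1 N)
  have hle' : ∀ M ∈ I, ∀ N ∈ I,
      g M N ≤ 2 * m * ((1 + 2 / d) * (a M N + a N M) + 2 / d * (η M * η N)) := by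
    intro M hM N hN
    rcases le_total M N with h | h
    · refine (hle M hM N hN h).trans ?_
      have := ha0 N M
      gcongr
      linarith
    · rw [hgsymm]
      refine (hle N hN M hM h).trans ?_
      rw [mul_comm (η N)]
      have := ha0 M N
      gcongr
      linarith
  have hasum : ∑ M ∈ I, ∑ N ∈ I, a M N ≤ 2 * H := by
    rw [Finset.sum_comm, hH, Finset.mul_sum]
    refine Finset.sum_le_sum fun N _ => ?_
    simp only [ha]
    rw [← Finset.mul_sum, mul_comm]
    exact mul_le_mul_of_nonneg_right (sum_filter_two_pow_div_le I N) (hη N)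
  have hgsum : ∑ M ∈ I, ∑ N ∈ I, g M N ≤ 2 * m * H ^ 2 * (4 + 10 / d) := by
    calc ∑ M ∈ I, ∑ N ∈ I, g M N
        ≤ ∑ M ∈ I, ∑ N ∈ I,
            2 * m * ((1 + 2 / d) * (a M N + a N M) + 2 / d * (η M * η N)) :=
          Finset.sum_le_sum fun M hM => Finset.sum_le_sum fun N hN => hle' M hM N hN
      _ = 2 * m * ((1 + 2 / d) * (∑ M ∈ I, ∑ N ∈ I, a M N + ∑ M ∈ I, ∑ N ∈ I, a M N) +
            2 / d * (H * H)) := by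
          simp only [← Finset.mul_sum, Finset.sum_add_distrib]
          rw [Finset.sum_comm (f := fun M N => a N M), hH, Finset.sum_mul_sum]
          simp only [← Finset.mul_sum]
      _ ≤ 2 * m * ((1 + 2 / d) * (2 * H ^ 2 + 2 * H ^ 2) + 2 / d * (H * H)) := by
          have : H ≤ H ^ 2 := le_self_pow₀ hsum two_ne_zero
          gcongr <;> linarith
      _ = _ := by ring
  have hmain := two_mul_sum_measureReal_le volume (I.sigma V)
    (fun x => Metric.ball (p x.2) (r x.1)) (fun _ _ => measurableSet_ball)
    (fun _ _ => measure_ball_lt_top.ne) (H * (4 + 10 / d))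
  have hfirst : ∑ x ∈ I.sigma V, volume.real (Metric.ball (p x.2) (r x.1)) = 2 * m * H := by
    rw [Finset.sum_sigma, hH, Finset.mul_sum]
    refine Finset.sum_congr rfl fun N hN => ?_
    simp only [Real.volume_real_ball (hr0 N), Finset.sum_const, nsmul_eq_mul, hcard N hN]
    simp only [hr]
    field_simp
  have hsecond : ∑ x ∈ I.sigma V, ∑ y ∈ I.sigma V,
      volume.real (Metric.ball (p x.2) (r x.1) ∩ Metric.ball (p y.2) (r y.1)) =
        ∑ M ∈ I, ∑ N ∈ I, g M N := by
    rw [Finset.sum_sigma]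
    refine Finset.sum_congr rfl fun M _ => ?_
    simp only [Finset.sum_sigma]
    rw [Finset.sum_comm]
  have hunion : (⋃ x ∈ I.sigma V, Metric.ball (p x.2) (r x.1)) =
      ⋃ N ∈ I, ⋃ i ∈ V N, Metric.ball (p i) (η N / 2 ^ N) := by
    ext z
    simp only [Set.mem_iUnion, Finset.mem_sigma, hr]
    constructor
    · rintro ⟨⟨N, i⟩, ⟨hN, hi⟩, hz⟩
      exact ⟨N, hN, i, hi, hz⟩
    · rintro ⟨N, hN, i, hi, hz⟩
      exact ⟨⟨N, i⟩, ⟨hN, hi⟩, hz⟩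
  rw [hfirst, hsecond, hunion] at hmain
  set G := volume.real (⋃ N ∈ I, ⋃ i ∈ V N, Metric.ball (p i) (η N / 2 ^ N))
  have hQ : 0 < 4 + 10 / d := by positivity
  have h3 : 2 * m * (H ^ 2 * (4 + 10 / d)) ≤ G * (4 + 10 / d) * (H ^ 2 * (4 + 10 / d)) := by
    nlinarith
  rw [div_le_iff₀ hQ]
  exact le_of_mul_le_mul_right h3 (by positivity)

/-! ### Fixed points of words -/

/-- The point fixed by the expanding maps along a nonempty word. -/
noncomputable def wordFixedPoint (b : ℝ) (w : List (Fin 2)) : ℝ :=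
  wordSum b w / (b ^ w.length - 1)

theorem expandWord_sub_self {b : ℝ} (hb : 1 < b) {w : List (Fin 2)} (hw : w ≠ []) (x : ℝ) :
    expandWord b w x - x = (b ^ w.length - 1) * (x - wordFixedPoint b w) := by
  have : 1 < b ^ w.length := one_lt_pow₀ hb (by simpa using hw)
  rw [expandWord_eq, wordFixedPoint]
  field_simp [(by linarith : b ^ w.length - 1 ≠ 0)]
  ring

theorem wordSum_mem_Icc {b : ℝ} (hb : 1 < b) (w : List (Fin 2)) :
    wordSum b w ∈ Set.Icc 0 (b / (b - 1) * (b ^ w.length - 1)) := by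
  have hb1 : 0 < b - 1 := by linarith
  induction w using List.reverseRecOn with
  | nil => simp [wordSum]
  | append_singleton w i ih =>
    obtain ⟨h0, h1⟩ := ih
    have hi0 : (0 : ℝ) ≤ ((i : ℕ) : ℝ) := Nat.cast_nonneg _
    have hi1 : ((i : ℕ) : ℝ) ≤ 1 := by fin_cases i <;> simp
    rw [wordSum_concat, List.length_append, List.length_singleton]
    refine ⟨by positivity, ?_⟩
    calc b * (wordSum b w + ((i : ℕ) : ℝ))
        ≤ b * (b / (b - 1) * (b ^ w.length - 1) + 1) := by gcongr
      _ = _ := by field_simp; ring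

theorem wordFixedPoint_mem {b : ℝ} (hb : 1 < b) {w : List (Fin 2)} (hw : w ≠ []) :
    wordFixedPoint b w ∈ baseInterval b := by
  have : 1 < b ^ w.length := one_lt_pow₀ hb (by simpa using hw)
  obtain ⟨h0, h1⟩ := wordSum_mem_Icc hb w
  refine ⟨div_nonneg h0 (by linarith), ?_⟩
  rw [wordFixedPoint, div_le_iff₀ (by linarith)]
  exact h1

/-- The fixed point of a word lies in the cylinder of every prefix of the word. -/
theorem expandWord_wordFixedPoint_mem {b : ℝ} (hb : 1 < b) {u v : List (Fin 2)}
    (hw : u ++ v ≠ []) : expandWord b u (wordFixedPoint b (u ++ v)) ∈ baseInterval b := by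
  refine mem_baseInterval_of_expandWord hb v ?_
  have h := expandWord_sub_self hb hw (wordFixedPoint b (u ++ v))
  rw [sub_self, mul_zero, sub_eq_zero] at h
  rw [← expandWord_append, h]
  exact wordFixedPoint_mem hb hw

theorem le_abs_wordFixedPoint_sub {b c : ℝ} (hb : 1 < b) (hc : 0 < c)
    (hsep : ∀ w w' : List (Fin 2), w.length = w'.length → w ≠ w' →
      c * (b / 2) ^ w.length ≤ |wordSum b w - wordSum b w'|) {w w' : List (Fin 2)}
    (hl : w.length = w'.length) (hne : w ≠ w') :
    c / 2 ^ w.length ≤ |wordFixedPoint b w - wordFixedPoint b w'| := by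
  have hw : w.length ≠ 0 := fun h => hne (by
    rw [List.eq_nil_of_length_eq_zero h, List.eq_nil_of_length_eq_zero (hl.symm.trans h)])
  have h1 : 1 < b ^ w.length := one_lt_pow₀ hb hw
  rw [wordFixedPoint, wordFixedPoint, ← hl, ← sub_div, abs_div,
    abs_of_pos (show 0 < b ^ w.length - 1 by linarith), le_div_iff₀ (by linarith)]
  refine le_trans ?_ (hsep w w' hl hne)
  rw [div_pow, div_mul_eq_mul_div, mul_div_assoc']
  gcongr
  linarith

/-! ### Balls about the fixed points -/

/-- The fixed points of the words of length `N ≥ k` that begin with a word `u` of length `k` with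
`y ∈ S_u (X)` are all near `y`, and their number is governed by `coverCount`. By the second moment
bound, the balls about them fill a positive proportion of a neighbourhood of `y`. -/
theorem measureReal_iUnion_ball_inter_closedBall_ge {b c : ℝ} (hb : 1 < b) (hb2 : b < 2)
    (hc : 0 < c)
    (hsep : ∀ w w' : List (Fin 2), w.length = w'.length → w ≠ w' →
      c * (b / 2) ^ w.length ≤ |wordSum b w - wordSum b w'|)
    (η : ℕ → ℝ) (hη : ∀ N, 0 ≤ η N) (hη1 : ∀ N, η N ≤ 1) (I : Finset ℕ) (k : ℕ)
    (hI : ∀ N ∈ I, k ≤ N) (hI0 : ∀ N ∈ I, N ≠ 0) (hsum : 1 ≤ ∑ N ∈ I, η N) (y : ℝ) :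
    2 * (coverCount b k y / 2 ^ k) / (4 + 10 / c) ≤
      volume.real (Metric.closedBall y (2 * ((b ^ k)⁻¹ * (b / (b - 1)))) ∩
        ⋃ N ∈ I, ⋃ w ∈ binaryWords N, Metric.ball (wordFixedPoint b w) (η N / 2 ^ N)) := by
  classical
  have hb0 : 0 < b := by linarith
  set V : ℕ → Finset (List (Fin 2)) := fun N =>
    (binaryWords N).filter fun w => expandWord b (w.take k) y ∈ baseInterval b with hV
  have hVlen : ∀ N, ∀ w ∈ V N, w.length = N := fun N w hw =>
    mem_binaryWords.1 (Finset.mem_filter.1 hw).1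
  have hcard : ∀ N ∈ I, ((V N).card : ℝ) = coverCount b k y / 2 ^ k * 2 ^ N := by
    intro N hN
    obtain ⟨m, rfl⟩ := Nat.exists_eq_add_of_le (hI N hN)
    have h1 : ((V (k + m)).card : ℝ) = ∑ w ∈ binaryWords (k + m),
        (baseInterval b).indicator (1 : ℝ → ℝ) (expandWord b (w.take k) y) := by
      simp [hV, Set.indicator_apply, Finset.sum_boole]
    have h2 : ∀ u ∈ binaryWords k, ∑ v ∈ binaryWords m,
        (baseInterval b).indicator (1 : ℝ → ℝ) (expandWord b ((u ++ v).take k) y) =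
          (baseInterval b).indicator (1 : ℝ → ℝ) (expandWord b u y) * 2 ^ m := by
      intro u hu
      have := mem_binaryWords.1 hu
      subst this
      simp only [List.take_left, Finset.sum_const, card_binaryWords, nsmul_eq_mul]
      push_cast; ring
    rw [h1, sum_binaryWords_add, Finset.sum_congr rfl h2, ← Finset.sum_mul, pow_add]
    change coverCount b k y * 2 ^ m = _
    field_simp
  have hmain := measureReal_iUnion_ball_ge I V (wordFixedPoint b) η hc
    (div_nonneg (coverCount_nonneg b k y) (by positivity)) hη hη1 hcard
    (fun N _ w hw w' hw' hne => by
      have := le_abs_wordFixedPoint_sub hb hc hsep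
        ((hVlen N w hw).trans (hVlen N w' hw').symm) hne
      rwa [hVlen N w hw] at this) hsum
  refine hmain.trans (measureReal_mono ?_ (ne_top_of_le_ne_top
    measure_closedBall_lt_top.ne (measure_mono Set.inter_subset_left)))
  intro z hz
  simp only [Set.mem_iUnion] at hz
  obtain ⟨N, hN, w, hw, hz⟩ := hz
  refine ⟨?_, Set.mem_biUnion hN (Set.mem_biUnion (Finset.mem_filter.1 hw).1 hz)⟩
  have hwN := hVlen N w hw
  have hw0 : w.take k ++ w.drop k ≠ [] := by
    rw [List.take_append_drop]
    rintro rfl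
    exact hI0 N hN hwN.symm
  have h1 := expandWord_wordFixedPoint_mem hb hw0
  rw [List.take_append_drop] at h1
  have h2 := abs_sub_le_of_expandWord_mem hb _ h1 (Finset.mem_filter.1 hw).2
  rw [List.length_take, min_eq_left (hwN ▸ hI N hN)] at h2
  have h3 : η N / 2 ^ N ≤ (b ^ k)⁻¹ * (b / (b - 1)) := by
    have hX : 1 ≤ b / (b - 1) := by rw [le_div_iff₀] <;> linarith
    have : (b ^ k : ℝ) ≤ 2 ^ N := (pow_le_pow_left₀ hb0.le hb2.le k).trans
      (pow_le_pow_right₀ one_le_two (hI N hN))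
    calc η N / 2 ^ N ≤ 1 / b ^ k := by gcongr; exact hη1 N
      _ = (b ^ k)⁻¹ * 1 := by rw [mul_one, one_div]
      _ ≤ _ := by gcongr
  rw [Metric.mem_closedBall, Real.dist_eq]
  rw [Metric.mem_ball, Real.dist_eq] at hz
  calc |z - y| ≤ |z - wordFixedPoint b w| + |wordFixedPoint b w - y| := abs_sub_le _ _ _
    _ ≤ _ := by linarith

/-- Almost every point of the base interval lies in one of the balls of radius `η N / 2 ^ N` about
the fixed points of the words of length `N`, for some `N ≥ n₀`. -/
theorem ae_exists_mem_ball_wordFixedPoint {b c : ℝ} (hb : 1 < b) (hb2 : b < 2) (hc : 0 < c)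
    (hsep : ∀ w w' : List (Fin 2), w.length = w'.length → w ≠ w' →
      c * (b / 2) ^ w.length ≤ |wordSum b w - wordSum b w'|)
    (η : ℕ → ℝ) (hη : ∀ N, 0 ≤ η N) (hη1 : ∀ N, η N ≤ 1) (hns : ¬ Summable η) (n₀ : ℕ) :
    ∀ᵐ y, y ∈ baseInterval b → ∃ N ≥ n₀, ∃ w ∈ binaryWords N,
      y ∈ Metric.ball (wordFixedPoint b w) (η N / 2 ^ N) := by
  have hb0 : 0 < b := by linarith
  set A : Set ℝ := (⋃ N ≥ n₀, ⋃ w ∈ binaryWords N,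
    Metric.ball (wordFixedPoint b w) (η N / 2 ^ N))ᶜ with hA
  have hAm : MeasurableSet A := (isOpen_biUnion fun N _ => isOpen_biUnion fun w _ =>
    Metric.isOpen_ball).measurableSet.compl
  filter_upwards [ae_eventually_measureReal_diff_le hAm,
    ae_exists_frequently_le_coverCount hb hb2 hc hsep] with y hdens hcov hyX
  by_contra hcon
  have hyA : y ∈ A := by
    simp only [hA, Set.mem_compl_iff, Set.mem_iUnion]
    rintro ⟨N, hN, w, hw, h⟩
    exact hcon ⟨N, hN, w, hw, h⟩
  obtain ⟨δ, hδ, hfreq⟩ := hcov hyX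
  have hX : 0 < b / (b - 1) := div_pos hb0 (by linarith)
  have hr : Tendsto (fun k : ℕ => 2 * ((b ^ k)⁻¹ * (b / (b - 1)))) atTop (𝓝[>] 0) := by
    refine tendsto_nhdsWithin_iff.2 ⟨?_, Eventually.of_forall fun k => ?_⟩
    · have := ((tendsto_inv_atTop_zero.comp (tendsto_pow_atTop_atTop_of_one_lt hb)).mul_const
        (b / (b - 1))).const_mul 2
      simpa using this
    · have : 0 < (b ^ k)⁻¹ * (b / (b - 1)) := mul_pos (by positivity) hX
      exact mul_pos two_pos this
  set Q := 4 + 10 / c with hQdef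
  have hQ : 0 < Q := by positivity
  -- This density makes the part of the closed ball outside `A` half as large as the second moment
  -- bound allows.
  obtain ⟨k, hk, hk'⟩ := (hfreq.and_eventually
    (hr.eventually (hdens hyA (δ / (2 * Q * (b / (b - 1)))) (by positivity)))).exists
  obtain ⟨n, hn⟩ : ∃ n, 1 ≤ ∑ N ∈ Finset.Ico (max n₀ (k + 1)) n, η N := by
    by_contra! hlt
    refine hns (summable_of_sum_range_le
      (c := ∑ N ∈ Finset.range (max n₀ (k + 1)), η N + 1) hη fun n => ?_)
    rcases le_total (max n₀ (k + 1)) n with h | h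
    · rw [← Finset.sum_range_add_sum_Ico _ h]
      have := hlt n
      linarith
    · have := Finset.sum_le_sum_of_subset_of_nonneg (Finset.range_mono h) fun N _ _ => hη N
      linarith
  have hge := measureReal_iUnion_ball_inter_closedBall_ge hb hb2 hc hsep η hη hη1 _ k
    (fun N hN => by have := (Finset.mem_Ico.1 hN).1; omega)
    (fun N hN => by have := (Finset.mem_Ico.1 hN).1; omega) hn y
  have hsub : (Metric.closedBall y (2 * ((b ^ k)⁻¹ * (b / (b - 1)))) ∩
        ⋃ N ∈ Finset.Ico (max n₀ (k + 1)) n, ⋃ w ∈ binaryWords N,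
          Metric.ball (wordFixedPoint b w) (η N / 2 ^ N)) ⊆
      Metric.closedBall y (2 * ((b ^ k)⁻¹ * (b / (b - 1)))) \ A := by
    rintro z ⟨hz, hz'⟩
    refine ⟨hz, fun hzA => hzA ?_⟩
    simp only [Set.mem_iUnion] at hz' ⊢
    obtain ⟨N, hN, h⟩ := hz'
    exact ⟨N, by have := (Finset.mem_Ico.1 hN).1; omega, h⟩
  have hle := hge.trans ((measureReal_mono hsub (ne_top_of_le_ne_top
    measure_closedBall_lt_top.ne (measure_mono Set.sdiff_subset))).trans hk')
  rw [le_div_iff₀ (by positivity)] at hk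
  have h1 : δ * (b ^ k)⁻¹ ≤ coverCount b k y / 2 ^ k := by
    rw [le_div_iff₀ (by positivity)]
    refine le_trans (le_of_eq ?_) hk
    rw [div_pow]; ring
  have h2 : δ / (2 * Q * (b / (b - 1))) * (2 * ((b ^ k)⁻¹ * (b / (b - 1)))) =
      δ * (b ^ k)⁻¹ / Q := by
    have := hX.ne'
    generalize b / (b - 1) = X at *
    field_simp
  rw [h2, div_le_div_iff_of_pos_right hQ] at hle
  have h3 : 0 < δ * (b ^ k)⁻¹ := by positivity
  linarith

/-! ### The Bernoulli iterated function system -/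

theorem bernoulliIFS_T (l : ℝ) (hl : l ∈ Set.Ioo (1 / 2 : ℝ) 1) (i : Fin 2) (x : ℝ) :
    (bernoulliIFS l hl).T i x = l⁻¹ * (x - ((i : ℕ) : ℝ)) := by
  have h0 : l ≠ 0 := by have := hl.1; positivity
  have h1 : (bernoulliIFS l hl).S i (l⁻¹ * (x - ((i : ℕ) : ℝ))) = x := by
    fin_cases i <;> simp [AffineIFS.S, bernoulliIFS, Units.smul_def, h0]
  conv_lhs => rw [← h1]
  exact AffineIFS.T_S _ _ _

theorem bernoulliIFS_orbit (l : ℝ) (hl : l ∈ Set.Ioo (1 / 2 : ℝ) 1) (w : List (Fin 2)) (x : ℝ) :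
    (bernoulliIFS l hl).orbit w x = expandWord l⁻¹ w x := by
  simp only [AffineIFS.orbit, expandWord, bernoulliIFS_T]

theorem bernoulliIFS_detSum (l : ℝ) (hl : l ∈ Set.Ioo (1 / 2 : ℝ) 1) :
    (bernoulliIFS l hl).detSum = 2 * l := by
  have h0 : 0 < l := lt_trans (by norm_num) hl.1
  have : ∀ i, LinearMap.det (((bernoulliIFS l hl).lin i : ℝ →L[ℝ] ℝ) : ℝ →ₗ[ℝ] ℝ) = l := by
    intro i
    rw [LinearMap.det_ring]
    simp [bernoulliIFS, Units.smul_def]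
  rw [AffineIFS.detSum, Fin.sum_univ_two, this, this, abs_of_pos h0]
  ring

theorem baseInterval_subset_attractor (l : ℝ) (hl : l ∈ Set.Ioo (1 / 2 : ℝ) 1) :
    baseInterval l⁻¹ ⊆ (bernoulliIFS l hl).attractor := by
  have h0 : 0 < l := lt_trans (by norm_num) hl.1
  have hb : 1 < l⁻¹ := (one_lt_inv₀ h0).2 hl.2
  have hb2 : l⁻¹ ≤ 2 := by rw [inv_le_comm₀ h0 two_pos]; linarith [hl.1]
  refine Set.subset_sUnion_of_mem ⟨⟨0, le_rfl, div_nonneg (by linarith) (by linarith)⟩,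
    isCompact_Icc, ?_⟩
  ext x
  simp only [Set.mem_iUnion, Set.mem_image]
  constructor
  · intro hx
    obtain ⟨i, hi⟩ := exists_step_mem_baseInterval hb hb2 hx
    rw [← bernoulliIFS_T l hl] at hi
    exact ⟨i, _, hi, AffineIFS.S_T _ _ _⟩
  · rintro ⟨i, y, hy, rfl⟩
    refine mem_baseInterval_of_step hb i ?_
    rw [← bernoulliIFS_T l hl, AffineIFS.T_S]
    exact hy

theorem not_summable_min_one {f : ℕ → ℝ≥0} (hf : ¬ Summable f) :
    ¬ Summable fun n => min (f n : ℝ) 1 := by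
  intro h
  apply hf
  rw [← NNReal.summable_coe]
  refine h.congr_atTop ?_
  filter_upwards [h.tendsto_atTop_zero.eventually (gt_mem_nhds one_pos)] with n hn
  rcases min_lt_iff.1 hn with h | h
  · exact min_eq_left h.le
  · exact absurd h (lt_irrefl _)

theorem mainTheorem3 (l : ℝ) (hl : l ∈ Set.Ioo (1 / 2 : ℝ) 1) (hG : IsGarsiaNumber l⁻¹)
    (h : ℕ → ℝ≥0) (hh : ¬ Summable (fun n : ℕ => h (n + 1))) :
    ∀ᵐ x ∂(volume.restrict (Set.Icc (0 : ℝ) (1 / (1 - l)))),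
      x ∈ (bernoulliIFS l hl).recurrenceSet h := by
  have h0 : 0 < l := lt_trans (by norm_num) hl.1
  obtain ⟨hb, hb2⟩ := hG.1
  obtain ⟨c, hc, hsep⟩ := hG.exists_separation
  have hX : Set.Icc (0 : ℝ) (1 / (1 - l)) = baseInterval l⁻¹ := by
    have : 1 - l ≠ 0 := by linarith [hl.2]
    rw [baseInterval]
    congr 1
    field_simp
  have hns : ¬ Summable fun n => min (h n : ℝ) 1 :=
    not_summable_min_one fun hs => hh ((NNReal.summable_nat_add_iff 1).2 hs)
  rw [hX, ae_restrict_iff' (measurableSet_baseInterval _)]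
  have hae := fun n₀ => ae_exists_mem_ball_wordFixedPoint hb hb2 hc hsep (fun n => min (h n : ℝ) 1)
    (fun n => le_min (h n).2 zero_le_one) (fun n => min_le_right _ _) hns n₀
  filter_upwards [ae_all_iff.2 hae] with x hx hxX
  refine ⟨baseInterval_subset_attractor l hl hxX, ?_⟩
  -- A set of words is infinite as soon as the lengths of its members are unbounded.
  refine Set.Infinite.of_image List.length (Set.infinite_of_forall_exists_gt fun n => ?_)
  obtain ⟨N, hN, w, hw, hxw⟩ := hx (n + 1) hxX
  rw [mem_binaryWords] at hw
  subst hw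
  have hw0 : w ≠ [] := by rintro rfl; simp at hN
  refine ⟨w.length, ⟨w, ⟨hw0, ?_⟩, rfl⟩, hN⟩
  have hpow : 1 < l⁻¹ ^ w.length := one_lt_pow₀ hb (by simpa using hw0)
  rw [Metric.mem_ball, Real.dist_eq] at hxw ⊢
  rw [bernoulliIFS_orbit, expandWord_sub_self hb hw0, bernoulliIFS_detSum, Module.finrank_self,
    Nat.cast_one, div_one, Real.rpow_one, abs_mul, abs_of_pos (by linarith), mul_pow]
  calc (l⁻¹ ^ w.length - 1) * |x - wordFixedPoint l⁻¹ w|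
      ≤ l⁻¹ ^ w.length * |x - wordFixedPoint l⁻¹ w| := by gcongr; linarith
    _ < l⁻¹ ^ w.length * (min (h w.length : ℝ) 1 / 2 ^ w.length) := by gcongr
    _ ≤ l⁻¹ ^ w.length * (h w.length / 2 ^ w.length) := by gcongr; exact min_le_left _ _
    _ = h w.length / (2 ^ w.length * l ^ w.length) := by rw [inv_pow]; field_simp
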